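/- Let $V$ be a finite nonempty set of nodes and let $P=(p_{ij})_{i,j\in V}$ be an irreducible row-stochastic matrix (the directed network whose links are the pairs $(i,j)$ with $p_{ij}>0$ is strongly connected). Let $(X^{n}_t)_{t\ge 0}$, $n=0,1,2,\dots$, be independent random walks (Markov chains) on $V$ with transition matrix $P$ and arbitrary initial laws. For $N$ agents and period $T$, let $R(N,T)_{ij}$ be the number of pairs $(n,t)$ with $n<N$, $t<T$, $X^n_t=i$, $X^n_{t+1}=j$. For a real matrix $R$ with a nonzero entry, let its relative flow $\rho(R)$ be $R$ divided by its smallest nonzero entry. A square matrix is called premagic if its vector of row sums equals its vector of column sums. Then: 1. $P$ has exactly one stationary distribution $\pi$ (probability vector with $\pi P=\pi$), and $\pi_i>0$ for all $i$. Put $F=\rho\big((\pi_i p_{ij})_{i,j}\big)$, the ideal flow matrix. 2. Almost surely $\rho(R(N,T))\to F$ as $T\to\infty$, uniformly in the number $N\ge 1$ of agents. If moreover every agent starts with law $\pi$, then almost surely $\rho(R(N,T))\to F$ as $N\cdot T\to\infty$ in any manner. 3. $F$ is premagic. 4. All entries of $F$ are rational if and only if all transition probabilities $p_{ij}$ are rational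 (as they are for the simple random walk on a strongly connected directed graph). 5. If the entries of $F$ are rational and $L\ge 1$ is the least common multiple of their denominators, then $LF$ is a matrix of non-negative integers, it is premagic, and its relative flow is $F$. -/

import Mathlib

open MeasureTheory ProbabilityTheory Filter Topology

noncomputable section

namespace IdealFlow

/-- A square matrix is premagic if its vector of column sums `jᵀ M` equals its vector of
row sums `M j`, where `j` is the all-ones vector. -/
def IsPremagic {V R : Type*} [Fintype V] [NonAssocSemiring R] (M : Matrix V V R) : Prop :=
  Matrix.vecMul 1 M = Matrix.mulVec M 1

/-- The smallest nonzero entry of a matrix of link flows (`0` if there is no nonzero entry). -/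
def minFlow {V : Type*} (R : Matrix V V ℝ) : ℝ :=
  sInf {x : ℝ | ∃ i j, R i j ≠ 0 ∧ R i j = x}

/-- Relative flow: every link flow divided by the smallest nonzero link flow. -/
def relativeFlow {V : Type*} (R : Matrix V V ℝ) : Matrix V V ℝ :=
  Matrix.of fun i j => R i j / minFlow R

/-- `π` is a stationary distribution of the transition matrix `P`: a probability vector with
`π P = π`. -/
structure IsStationary {V : Type*} [Fintype V] (P : Matrix V V ℝ) (π : V → ℝ) : Prop where
  nonneg : ∀ i, 0 ≤ π i
  sum_eq_one : ∑ i, π i = 1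
  vecMul_eq : Matrix.vecMul π P = π

/-- `Y` is (the trajectory of) a random walk on `V` with transition matrix `P`: a time-homogeneous
Markov chain with an arbitrary initial law. -/
structure IsRandomWalk {V Ω : Type*} [MeasurableSpace V] [MeasurableSpace Ω]
    (P : Matrix V V ℝ) (μ : Measure Ω) (Y : ℕ → Ω → V) : Prop where
  measurable : ∀ t, Measurable (Y t)
  markov : ∀ (t : ℕ) (x : ℕ → V),
    μ.real {ω | ∀ s ≤ t + 1, Y s ω = x s} = μ.real {ω | ∀ s ≤ t, Y s ω = x s} * P (x t) (x (t + 1))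

/-- The link flow matrix of the first `N` agents over the period `T`: its entry `(i, j)` counts
the pairs (agent `n < N`, time `t < T`) for which agent `n` moves from `i` to `j` between the
times `t` and `t + 1`. -/
def linkFlow {V Ω : Type*} [DecidableEq V] (X : ℕ → ℕ → Ω → V) (N T : ℕ) (ω : Ω) :
    Matrix V V ℝ :=
  Matrix.of fun i j =>
    (((Finset.range N ×ˢ Finset.range T).filter
      fun p => X p.1 p.2 ω = i ∧ X p.1 (p.2 + 1) ω = j).card : ℝ)

/-- The least common multiple of the denominators of the entries of a rational matrix. -/
def denLcm {V : Type*} [Fintype V] (G : Matrix V V ℚ) : ℕ :=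
  (Finset.univ : Finset (V × V)).lcm fun p => (G p.1 p.2).den

end IdealFlow

end

/-! Uniqueness of `π` turns convergence of flows into two balance laws. Divide the link flow by `N *
T`. If its entries are asymptotically split along each row according to `P`, and its row and column
sums asymptotically agree, then every cluster point of the row-sum vectors in the simplex is
stationary, hence equals `π` (`tendsto_stationaryFlow`). Relative flow ignores positive scaling and
is continuous as long as no new links appear, so the limit passes to it.

The splitting error is a sum of bounded martingale differences. It is sub-Gaussian with variance
proxy `T` per agent and `N * T` for `N` independent agents, and Borel–Cantelli over all pairs `(N,
T)` gives convergence as `N * T → ∞` (`ae_tendsto_average_zero`). The balance error telescopes in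
time to at most `1` per agent: this is negligible as `T → ∞`, whereas bounded `T` requires the mean
zero supplied by a stationary start.

For rationality, existence of an invariant vector is proved over any ordered field: applied over
`ℚ`, with uniqueness over `ℝ`, it makes `π` rational. Conversely, normalising the rows of `F`
recovers `P`. -/

namespace IdealFlow

/-! ### Stationary vectors: existence, positivity, uniqueness -/

section Stationary

/-- The absolute value of a vector fixed by a stochastic matrix is fixed as well. -/
lemma abs_vecMul_eq {V K : Type*} [Fintype V] [DecidableEq V] [Field K] [LinearOrder K]
    [IsStrictOrderedRing K] {Q : Matrix V V K} (hQ : Q ∈ Matrix.rowStochastic K V)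
    {v : V → K} (hv : Matrix.vecMul v Q = v) :
    Matrix.vecMul (fun i => |v i|) Q = fun i => |v i| := by
  have hle : ∀ j ∈ Finset.univ, |v j| ≤ Matrix.vecMul (fun i => |v i|) Q j := by
    intro j _
    conv_lhs => rw [← hv]
    simp only [Matrix.vecMul, dotProduct]
    refine (Finset.abs_sum_le_sum_abs _ _).trans (Finset.sum_le_sum fun i _ => ?_)
    rw [abs_mul, abs_of_nonneg (Matrix.nonneg_of_mem_rowStochastic hQ)]
  -- Stochasticity preserves total mass, so the entrywise triangle inequality must be an equality
  -- everywhere.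
  have hsum : ∑ j, |v j| = ∑ j, Matrix.vecMul (fun i => |v i|) Q j := by
    simp only [Matrix.vecMul, dotProduct]
    rw [Finset.sum_comm]
    refine Finset.sum_congr rfl fun i _ => ?_
    rw [← Finset.mul_sum, Matrix.sum_row_of_mem_rowStochastic hQ, mul_one]
  funext j
  exact ((Finset.sum_eq_sum_iff_of_le hle).1 hsum j (Finset.mem_univ j)).symm

/-- A stochastic matrix over an ordered field has an invariant probability vector. -/
lemma exists_invariant {V K : Type*} [Fintype V] [DecidableEq V] [Nonempty V] [Field K]
    [LinearOrder K] [IsStrictOrderedRing K] {Q : Matrix V V K}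
    (hQ : Q ∈ Matrix.rowStochastic K V) :
    ∃ q : V → K, (∀ i, 0 ≤ q i) ∧ ∑ i, q i = 1 ∧ Matrix.vecMul q Q = q := by
  -- The all-ones vector is a right null vector of `Q - 1`; singularity then provides a left one.
  have hdet : (Q - 1).det = 0 := by
    refine Matrix.exists_mulVec_eq_zero_iff.1 ⟨1, one_ne_zero, ?_⟩
    rw [Matrix.sub_mulVec, Matrix.one_vecMul_of_mem_rowStochastic hQ, Matrix.one_mulVec, sub_self]
  obtain ⟨v, hv0, hv⟩ := Matrix.exists_vecMul_eq_zero_iff.2 hdet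
  rw [Matrix.vecMul_sub, Matrix.vecMul_one, sub_eq_zero] at hv
  have hpos : 0 < ∑ i, |v i| := by
    obtain ⟨i, hi⟩ := Function.ne_iff.1 hv0
    exact Finset.sum_pos' (fun i _ => abs_nonneg _) ⟨i, Finset.mem_univ i, abs_pos.2 hi⟩
  refine ⟨(∑ i, |v i|)⁻¹ • fun i => |v i|, fun i => ?_, ?_, ?_⟩
  · exact mul_nonneg (inv_nonneg.2 hpos.le) (abs_nonneg _)
  · simp only [Pi.smul_apply, smul_eq_mul]
    rw [← Finset.mul_sum, inv_mul_cancel₀ hpos.ne']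
  · rw [Matrix.smul_vecMul, abs_vecMul_eq hQ hv]

/-- A nonzero nonnegative vector fixed by an irreducible matrix is positive. -/
lemma pos_of_vecMul_eq {V : Type*} [Fintype V] [DecidableEq V] {P : Matrix V V ℝ}
    (hirr : P.IsIrreducible) {v : V → ℝ} (hv0 : ∀ i, 0 ≤ v i) (hv : Matrix.vecMul v P = v)
    {i : V} (hi : 0 < v i) (j : V) : 0 < v j := by
  obtain ⟨k, -, hk⟩ := (Matrix.isIrreducible_iff_exists_pow_pos hirr.nonneg).1 hirr i j
  have hpow : ∀ k : ℕ, Matrix.vecMul v (P ^ k) = v := by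
    intro k
    induction k with
    | zero => simp
    | succ k ih => rw [pow_succ, ← Matrix.vecMul_vecMul, ih, hv]
  rw [← hpow k]
  exact Finset.sum_pos' (fun a _ => mul_nonneg (hv0 a) (Matrix.pow_apply_nonneg hirr.nonneg k a j))
    ⟨i, Finset.mem_univ i, mul_pos hi hk⟩

variable {V : Type*} [Fintype V] {P : Matrix V V ℝ} {π : V → ℝ}

lemma IsStationary.pos [DecidableEq V] (h : IsStationary P π) (hirr : P.IsIrreducible)
    (j : V) : 0 < π j := by
  obtain ⟨i, -, hi⟩ : ∃ i ∈ Finset.univ, π i ≠ 0 :=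
    Finset.exists_ne_zero_of_sum_ne_zero (by rw [h.sum_eq_one]; exact one_ne_zero)
  exact pos_of_vecMul_eq hirr h.nonneg h.vecMul_eq ((h.nonneg i).lt_of_ne' hi) j

/-- The difference `v` has sum zero, and `|v| + v` is nonnegative and fixed. If `v` were positive
somewhere, `|v| + v` would be positive everywhere, hence so would `v`, contradicting the zero sum.
So `v ≤ 0`, and then `v = 0`. -/
lemma IsStationary.eq [DecidableEq V] (hP : P ∈ Matrix.rowStochastic ℝ V)
    (hirr : P.IsIrreducible) {π' : V → ℝ} (h : IsStationary P π) (h' : IsStationary P π') :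
    π' = π := by
  set v : V → ℝ := π' - π with hv
  have hvP : Matrix.vecMul v P = v := by rw [hv, Matrix.sub_vecMul, h.vecMul_eq, h'.vecMul_eq]
  have hsum : ∑ i, v i = 0 := by
    simp [hv, Finset.sum_sub_distrib, h.sum_eq_one, h'.sum_eq_one]
  have hw : Matrix.vecMul ((fun i => |v i|) + v) P = (fun i => |v i|) + v := by
    rw [Matrix.add_vecMul, abs_vecMul_eq hP hvP, hvP]
  have hw0 : ∀ i, 0 ≤ ((fun i => |v i|) + v) i := fun i => by
    simpa [add_comm] using neg_le_iff_add_nonneg.1 (neg_abs_le (v i))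
  have hnp : ∀ i, v i ≤ 0 := by
    intro i
    by_contra! hi
    have hpos := pos_of_vecMul_eq hirr hw0 hw (i := i)
      (add_pos_of_nonneg_of_pos (abs_nonneg _) hi)
    have hvpos : ∀ j, 0 < v j := by
      intro j
      by_contra! hj
      have := hpos j
      simp [abs_of_nonpos hj] at this
    exact hsum.not_gt (Finset.sum_pos (fun j _ => hvpos j) ⟨i, Finset.mem_univ i⟩)
  have := (Finset.sum_eq_zero_iff_of_nonpos fun i _ => hnp i).1 hsum
  funext i
  exact sub_eq_zero.1 (this i (Finset.mem_univ i))

end Stationary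

/-! ### Scaling and continuity of the relative flow -/

section RelativeFlow

variable {V : Type*}

lemma minFlow_mem [Finite V] {R : Matrix V V ℝ} (hR : R ≠ 0) :
    ∃ i j, R i j ≠ 0 ∧ R i j = minFlow R := by
  have hfin : {x : ℝ | ∃ i j, R i j ≠ 0 ∧ R i j = x}.Finite := by
    refine (Set.finite_range fun p : V × V => R p.1 p.2).subset ?_
    rintro x ⟨i, j, -, rfl⟩
    exact ⟨(i, j), rfl⟩
  have hne : {x : ℝ | ∃ i j, R i j ≠ 0 ∧ R i j = x}.Nonempty := by
    by_contra h
    refine hR (Matrix.ext fun i j => ?_)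
    by_contra hij
    exact h ⟨_, i, j, hij, rfl⟩
  exact hne.csInf_mem hfin

lemma minFlow_pos [Finite V] {R : Matrix V V ℝ} (h0 : ∀ i j, 0 ≤ R i j) (hR : R ≠ 0) :
    0 < minFlow R := by
  obtain ⟨i, j, hij, h⟩ := minFlow_mem hR
  rw [← h]
  exact (h0 i j).lt_of_ne' hij

open scoped Pointwise in
lemma minFlow_smul {c : ℝ} (hc : 0 < c) (R : Matrix V V ℝ) :
    minFlow (c • R) = c * minFlow R := by
  have : {x : ℝ | ∃ i j, (c • R) i j ≠ 0 ∧ (c • R) i j = x} =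
      c • {x : ℝ | ∃ i j, R i j ≠ 0 ∧ R i j = x} := by
    ext x
    simp only [Matrix.smul_apply, smul_eq_mul, Set.mem_smul_set, Set.mem_ofPred_eq]
    constructor
    · rintro ⟨i, j, h, rfl⟩
      exact ⟨_, ⟨i, j, right_ne_zero_of_mul h, rfl⟩, rfl⟩
    · rintro ⟨_, ⟨i, j, h, rfl⟩, rfl⟩
      exact ⟨i, j, mul_ne_zero hc.ne' h, rfl⟩
  rw [minFlow, this, Real.sInf_smul_of_nonneg hc.le, smul_eq_mul, minFlow]

lemma relativeFlow_smul {c : ℝ} (hc : 0 < c) (R : Matrix V V ℝ) :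
    relativeFlow (c • R) = relativeFlow R := by
  ext i j
  simp only [relativeFlow, Matrix.of_apply, minFlow_smul hc, Matrix.smul_apply, smul_eq_mul]
  exact mul_div_mul_left _ _ hc.ne'

lemma relativeFlow_eq_smul (R : Matrix V V ℝ) : relativeFlow R = (minFlow R)⁻¹ • R := by
  ext i j
  simp [relativeFlow, div_eq_inv_mul]

/-- The relative flow is continuous along matrices with no more links than the limit. -/
lemma tendsto_relativeFlow [Finite V] {α : Type*} {l : Filter α} {R : α → Matrix V V ℝ}
    {A : Matrix V V ℝ} (hA0 : ∀ i j, 0 ≤ A i j) (hA : A ≠ 0) (hR : Tendsto R l (𝓝 A))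
    (hz : ∀ a i j, A i j = 0 → R a i j = 0) :
    Tendsto (fun a => relativeFlow (R a)) l (𝓝 (relativeFlow A)) := by
  have hent : ∀ i j, Tendsto (fun a => R a i j) l (𝓝 (A i j)) := fun i j =>
    tendsto_pi_nhds.1 (tendsto_pi_nhds.1 hR i) j
  -- Eventually both matrices have the same support, so each minimum can be compared with the entry
  -- at the other's minimiser.
  have hm : Tendsto (fun a => minFlow (R a)) l (𝓝 (minFlow A)) := by
    rw [Metric.tendsto_nhds]
    intro ε hε
    have hpos : ∀ᶠ a in l, ∀ i j, A i j ≠ 0 → R a i j ≠ 0 := by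
      simp only [eventually_all]
      exact fun i j hij => (hent i j).eventually_ne hij
    have hclose : ∀ᶠ a in l, ∀ i j, |R a i j - A i j| < ε := by
      simp only [eventually_all]
      exact fun i j => (Metric.tendsto_nhds.1 (hent i j)) ε hε
    filter_upwards [hpos, hclose] with a ha hc
    obtain ⟨i, j, hij, h⟩ := minFlow_mem hA
    have hRa : R a ≠ 0 := fun h0 => ha i j hij (by rw [h0]; rfl)
    obtain ⟨i', j', hij', h'⟩ := minFlow_mem hRa
    have hbdd : ∀ B : Matrix V V ℝ, BddBelow {x : ℝ | ∃ i j, B i j ≠ 0 ∧ B i j = x} := by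
      intro B
      refine ((Set.finite_range fun p : V × V => B p.1 p.2).subset ?_).bddBelow
      rintro x ⟨i, j, -, rfl⟩
      exact ⟨(i, j), rfl⟩
    have h1 : minFlow (R a) ≤ R a i j := csInf_le (hbdd _) ⟨i, j, ha i j hij, rfl⟩
    have h2 : minFlow A ≤ A i' j' :=
      csInf_le (hbdd _) ⟨i', j', fun h0 => hij' (hz a i' j' h0), rfl⟩
    rw [Real.dist_eq, abs_lt]
    have h3 := abs_lt.1 (hc i j)
    have h4 := abs_lt.1 (hc i' j')
    constructor <;> linarith [h3.1, h3.2, h4.1, h4.2]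
  simp only [relativeFlow_eq_smul]
  exact (hm.inv₀ (minFlow_pos hA0 hA).ne').smul hR

end RelativeFlow

/-! ### Markov property and exponential moments -/

section RandomWalk

lemma IsRandomWalk.measure_snoc {V Ω : Type*} [MeasurableSpace V] [MeasurableSpace Ω]
    {P : Matrix V V ℝ} {μ : Measure Ω} {Y : ℕ → Ω → V} (hY : IsRandomWalk P μ Y)
    (t : ℕ) (x : Fin (t + 1) → V) (b : V) :
    μ.real {ω | (fun s : Fin (t + 2) => Y s ω) = Fin.snoc (α := fun _ => V) x b} =
      μ.real {ω | (fun s : Fin (t + 1) => Y s ω) = x} * P (x (Fin.last t)) b := by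
  -- The Markov axiom takes infinite sequences; the values after time `t + 1` do not matter.
  set z : ℕ → V := fun s => if h : s < t + 1 then x ⟨s, h⟩ else b with hz
  have hz1 : ∀ s : Fin (t + 1), z s = x s := fun s => dif_pos s.2
  have hz2 : z (t + 1) = b := by simp [hz]
  have h := hY.markov t z
  have hlast : z t = x (Fin.last t) := hz1 (Fin.last t)
  rw [hlast, hz2] at h
  convert h using 3
  · ext ω
    rw [funext_iff, Fin.forall_iff_castSucc]
    simp only [Fin.snoc_castSucc, Fin.snoc_last, Fin.val_castSucc, Fin.val_last]
    constructor
    · rintro ⟨h1, h2⟩ s hs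
      rcases hs.lt_or_eq with hs | rfl
      · exact (h2 ⟨s, hs⟩).trans (hz1 ⟨s, hs⟩).symm
      · exact h1.trans hz2.symm
    · intro h
      exact ⟨(h _ le_rfl).trans hz2, fun s => (h s s.2.le).trans (hz1 s)⟩
  · ext ω
    simp only [Set.mem_ofPred_eq, funext_iff]
    constructor
    · exact fun h s hs => (h ⟨s, Nat.lt_succ_of_le hs⟩).trans (hz1 ⟨s, Nat.lt_succ_of_le hs⟩).symm
    · exact fun h s => (h s (Nat.le_of_lt_succ s.2)).trans (hz1 s)

variable {V Ω : Type*} [Fintype V] [MeasurableSpace V] [MeasurableSingletonClass V]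
  [MeasurableSpace Ω] {P : Matrix V V ℝ} {μ : Measure Ω} [IsProbabilityMeasure μ]
  {Y : ℕ → Ω → V}

lemma IsRandomWalk.integral_path (hY : IsRandomWalk P μ Y) (t : ℕ)
    (F : (Fin (t + 1) → V) → ℝ) :
    ∫ ω, F (fun s => Y s ω) ∂μ = ∑ x, μ.real {ω | (fun s : Fin (t + 1) => Y s ω) = x} * F x := by
  have hm : Measurable fun ω => fun s : Fin (t + 1) => Y s ω :=
    measurable_pi_lambda _ fun s => hY.measurable s
  have : IsProbabilityMeasure (μ.map fun ω => fun s : Fin (t + 1) => Y s ω) :=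
    Measure.isProbabilityMeasure_map hm.aemeasurable
  rw [← integral_map hm.aemeasurable (Measurable.of_discrete (f := F)).aestronglyMeasurable,
    integral_fintype .of_finite]
  refine Finset.sum_congr rfl fun x _ => ?_
  rw [map_measureReal_apply hm (measurableSet_singleton x), smul_eq_mul]
  rfl

/-- The Markov property in integrated form. -/
lemma IsRandomWalk.integral_mul_step (hY : IsRandomWalk P μ Y) (t : ℕ)
    (F : (Fin (t + 1) → V) → ℝ) (φ : V → V → ℝ) :
    ∫ ω, F (fun s => Y s ω) * φ (Y t ω) (Y (t + 1) ω) ∂μ =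
      ∫ ω, F (fun s => Y s ω) * ∑ b, P (Y t ω) b * φ (Y t ω) b ∂μ := by
  have h1 := hY.integral_path (t + 1) fun x =>
    F (fun s => x s.castSucc) * φ (x (Fin.last t).castSucc) (x (Fin.last (t + 1)))
  have h2 := hY.integral_path t fun x =>
    F x * ∑ b, P (x (Fin.last t)) b * φ (x (Fin.last t)) b
  simp only [Fin.val_castSucc, Fin.val_last] at h1 h2
  rw [h1, h2, ← (Fin.snocEquiv fun _ : Fin (t + 2) => V).sum_comp, Fintype.sum_prod_type_right]
  refine Finset.sum_congr rfl fun x _ => ?_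
  rw [Finset.mul_sum, Finset.mul_sum]
  refine Finset.sum_congr rfl fun b _ => ?_
  have := hY.measure_snoc t x b
  simp only [Fin.snocEquiv, Equiv.coe_fn_mk, Fin.snoc_castSucc, Fin.snoc_last] at this ⊢
  rw [this]
  ring

/-- Supplies the support condition without which the smallest nonzero entry, and so the relative
flow, need not converge. -/
lemma IsRandomWalk.ae_step_ne (hY : IsRandomWalk P μ Y) {i j : V} (hij : P i j = 0) (t : ℕ) :
    ∀ᵐ ω ∂μ, ¬(Y t ω = i ∧ Y (t + 1) ω = j) := by
  classical
  have h := hY.integral_mul_step t (fun _ => 1) fun a b => if a = i ∧ b = j then 1 else 0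
  have hz : ∀ a, ∑ b, P a b * (if a = i ∧ b = j then (1 : ℝ) else 0) = 0 := fun a => by
    refine Finset.sum_eq_zero fun b _ => ?_
    split_ifs with hab
    · rw [hab.1, hab.2, hij, zero_mul]
    · rw [mul_zero]
  simp only [hz, mul_zero, integral_zero, one_mul] at h
  have hms : MeasurableSet {ω | Y t ω = i ∧ Y (t + 1) ω = j} :=
    (hY.measurable t (measurableSet_singleton i)).inter
      (hY.measurable (t + 1) (measurableSet_singleton j))
  have hind : (fun ω => if Y t ω = i ∧ Y (t + 1) ω = j then (1 : ℝ) else 0) =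
      {ω | Y t ω = i ∧ Y (t + 1) ω = j}.indicator 1 := by
    funext ω
    simp [Set.indicator_apply]
  rw [hind, integral_indicator_one hms, measureReal_eq_zero_iff] at h
  exact measure_eq_zero_iff_ae_notMem.1 h

/-- A walk started from a stationary law keeps this law. -/
lemma IsRandomWalk.measureReal_eq (hY : IsRandomWalk P μ Y) {π : V → ℝ}
    (hπ : Matrix.vecMul π P = π) (h0 : ∀ i, μ.real {ω | Y 0 ω = i} = π i) (t : ℕ) (i : V) :
    μ.real {ω | Y t ω = i} = π i := by
  classical
  have hms : ∀ t i, MeasurableSet {ω | Y t ω = i} := fun t i =>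
    hY.measurable t (measurableSet_singleton i)
  have hint : ∀ t i, ∫ ω, (if Y t ω = i then (1 : ℝ) else 0) ∂μ = μ.real {ω | Y t ω = i} := by
    intro t i
    rw [← integral_indicator_one (hms t i)]
    exact integral_congr_ae (ae_of_all _ fun ω => by simp [Set.indicator_apply])
  induction t generalizing i with
  | zero => exact h0 i
  | succ t ih =>
    have h := hY.integral_mul_step t (fun _ => 1) fun _ b => if b = i then 1 else 0
    simp only [one_mul, mul_ite, mul_one, mul_zero, Finset.sum_ite_eq', Finset.mem_univ,
      if_true] at h
    rw [← hint, h]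
    have hP : ∀ ω, P (Y t ω) i = ∑ a, (if Y t ω = a then (1 : ℝ) else 0) * P a i := fun ω => by
      simp
    simp only [hP]
    rw [integral_finsetSum]
    · simp only [integral_mul_const, hint, ih]
      exact congrFun hπ i
    · intro a _
      refine Integrable.mul_const (Integrable.of_mem_Icc 0 1 ?_ (ae_of_all _ fun ω => ?_)) _
      · exact (Measurable.ite (hms t a) measurable_const measurable_const).aemeasurable
      · split_ifs <;> simp

/-- Sums of bounded martingale increments along a random walk are sub-Gaussian. -/
lemma IsRandomWalk.hasSubgaussianMGF_sum (hY : IsRandomWalk P μ Y) (hP : ∀ a b, 0 ≤ P a b)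
    (hP1 : ∀ a, ∑ b, P a b = 1) {D : V → V → ℝ} (hD : ∀ a b, |D a b| ≤ 1)
    (hD0 : ∀ a, ∑ b, P a b * D a b = 0) (T : ℕ) :
    HasSubgaussianMGF (fun ω => ∑ t ∈ Finset.range T, D (Y t ω) (Y (t + 1) ω)) T μ := by
  have hexp : ∀ (T : ℕ) (r : ℝ), Integrable
      (fun ω => Real.exp (r * ∑ t ∈ Finset.range T, D (Y t ω) (Y (t + 1) ω))) μ := by
    intro T r
    refine integrable_exp_mul_of_mem_Icc (a := -T) (b := T) ?_ (ae_of_all _ fun ω => ?_)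
    · refine (Finset.measurable_fun_sum _ fun t _ => ?_).aemeasurable
      exact (Measurable.of_discrete (f := fun p : V × V => D p.1 p.2)).comp
        ((hY.measurable t).prodMk (hY.measurable (t + 1)))
    · rw [Set.mem_Icc, ← abs_le]
      refine (Finset.abs_sum_le_sum_abs _ _).trans
        ((Finset.sum_le_sum fun t _ => hD _ _).trans (by simp))
  refine ⟨hexp T, fun r => ?_⟩
  induction T with
  | zero => simp [mgf]
  | succ T ih =>
    have hstep : ∀ a, ∑ b, P a b * Real.exp (r * D a b) ≤ Real.exp (r ^ 2 / 2) := by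
      intro a
      -- The chord of `exp` over `[-r, r]`; its linear term has zero mean under `P a`, as in
      -- Hoeffding's lemma.
      have hconv : ∀ b, Real.exp (r * D a b) ≤ Real.cosh r + D a b * Real.sinh r := by
        intro b
        have hb := abs_le.1 (hD a b)
        have := convexOn_exp.2 (Set.mem_univ r) (Set.mem_univ (-r))
          (show 0 ≤ (1 + D a b) / 2 by linarith) (show 0 ≤ (1 - D a b) / 2 by linarith) (by ring)
        simp only [smul_eq_mul] at this
        rw [Real.cosh_eq, Real.sinh_eq]
        calc Real.exp (r * D a b)
            = Real.exp ((1 + D a b) / 2 * r + (1 - D a b) / 2 * -r) := by congr 1; ring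
          _ ≤ _ := this
          _ = _ := by ring
      calc ∑ b, P a b * Real.exp (r * D a b)
          ≤ ∑ b, (P a b * Real.cosh r + P a b * D a b * Real.sinh r) :=
            Finset.sum_le_sum fun b _ =>
              (mul_le_mul_of_nonneg_left (hconv b) (hP a b)).trans_eq (by ring)
        _ = Real.cosh r := by
            rw [Finset.sum_add_distrib, ← Finset.sum_mul, ← Finset.sum_mul, hP1, hD0]; ring
        _ ≤ _ := Real.cosh_le_exp_half_sq r
    have h := hY.integral_mul_step T
      (fun x => Real.exp (r * ∑ t : Fin T, D (x t.castSucc) (x t.succ)))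
      fun a b => Real.exp (r * D a b)
    have hsum : ∀ ω, ∑ t : Fin T, D (Y t.castSucc ω) (Y t.succ ω) =
        ∑ t ∈ Finset.range T, D (Y t ω) (Y (t + 1) ω) := fun ω => by
      rw [Finset.sum_range]; rfl
    simp only [hsum, ← Real.exp_add, ← mul_add, ← Finset.sum_range_succ] at h
    rw [mgf, h]
    calc ∫ ω, Real.exp (r * ∑ t ∈ Finset.range T, D (Y t ω) (Y (t + 1) ω)) *
          ∑ b, P (Y T ω) b * Real.exp (r * D (Y T ω) b) ∂μ
        ≤ ∫ ω, Real.exp (r * ∑ t ∈ Finset.range T, D (Y t ω) (Y (t + 1) ω)) *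
          Real.exp (r ^ 2 / 2) ∂μ := by
          refine integral_mono_of_nonneg (ae_of_all _ fun ω => ?_) ((hexp T r).mul_const _)
            (ae_of_all _ fun ω => mul_le_mul_of_nonneg_left (hstep _) (Real.exp_pos _).le)
          exact mul_nonneg (Real.exp_pos _).le
            (Finset.sum_nonneg fun b _ => mul_nonneg (hP _ _) (Real.exp_pos _).le)
      _ ≤ Real.exp (T * r ^ 2 / 2) * Real.exp (r ^ 2 / 2) := by
          rw [integral_mul_const]
          exact mul_le_mul_of_nonneg_right (by simpa [mgf] using ih) (Real.exp_pos _).le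
      _ = _ := by
          rw [← Real.exp_add]
          congr 1
          push_cast
          ring

end RandomWalk

/-! ### Tail bounds and a two-parameter strong law -/

section LargeDeviations

variable {Ω : Type*} [MeasurableSpace Ω] {μ : Measure Ω}

lemma HasSubgaussianMGF.measure_abs_ge_le [IsFiniteMeasure μ] {Z : Ω → ℝ} {c : NNReal}
    (h : HasSubgaussianMGF Z c μ) {ε : ℝ} (hε : 0 ≤ ε) :
    μ.real {ω | ε ≤ |Z ω|} ≤ 2 * Real.exp (-ε ^ 2 / (2 * c)) := by
  have hsub : {ω | ε ≤ |Z ω|} ⊆ {ω | ε ≤ Z ω} ∪ {ω | ε ≤ (-Z) ω} := by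
    intro ω (hω : ε ≤ |Z ω|)
    rcases le_abs.1 hω with h | h
    · exact Or.inl h
    · exact Or.inr h
  calc μ.real {ω | ε ≤ |Z ω|} ≤ μ.real ({ω | ε ≤ Z ω} ∪ {ω | ε ≤ (-Z) ω}) :=
        measureReal_mono hsub
    _ ≤ _ := measureReal_union_le _ _
    _ ≤ _ := add_le_add (h.measure_ge_le hε) (h.neg.measure_ge_le hε)
    _ = _ := by ring

/-- A strong law for two-parameter averages: sub-Gaussian sums `S n T` of variance proxy `T`,
independent in `n`, average to zero as the product of the two parameters grows. -/
lemma ae_tendsto_average_zero [IsProbabilityMeasure μ] {S : ℕ → ℕ → Ω → ℝ}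
    (hS : ∀ n T, HasSubgaussianMGF (S n T) T μ) (hind : ∀ T, iIndepFun (fun n => S n T) μ) :
    ∀ᵐ ω ∂μ, Tendsto
      (fun p : ℕ × ℕ => (∑ n ∈ Finset.range p.1, S n p.2 ω) / ((p.1 * p.2 : ℕ) : ℝ))
      (comap (fun p : ℕ × ℕ => p.1 * p.2) atTop) (𝓝 0) := by
  have hsub : ∀ N T, HasSubgaussianMGF (fun ω => ∑ n ∈ Finset.range N, S n T ω)
      ((N * T : ℕ) : NNReal) μ := by
    intro N T
    simpa using HasSubgaussianMGF.sum_of_iIndepFun (hind T) (s := Finset.range N)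
      (c := fun _ => (T : NNReal)) fun n _ => hS n T
  -- Borel–Cantelli. The condition `0 < p.1 * p.2` removes pairs with a zero parameter, where the
  -- inequality could hold as `0 ≤ 0` infinitely often.
  have key : ∀ ε : ℝ, 0 < ε → ∀ᵐ ω ∂μ, {p : ℕ × ℕ | ω ∈ {ω | 0 < p.1 * p.2 ∧
      ε * (p.1 * p.2 : ℕ) ≤ |∑ n ∈ Finset.range p.1, S n p.2 ω|}}.Finite := by
    intro ε hε
    refine ae_finite_setOfPred_mem ?_
    -- The Gaussian exponent is `-2 * c * (N * T)`, at most `-c * (N + T)` since `N + T ≤ 2 * N * T`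
    -- for positive integers. This yields a product of geometric series.
    set c : ℝ := ε ^ 2 / 4 with hc
    have hc0 : 0 < c := by positivity
    have hgeo : Summable fun n : ℕ => Real.exp (-c) ^ n :=
      summable_geometric_of_lt_one (Real.exp_pos _).le (Real.exp_lt_one_iff.2 (by linarith))
    have hsum : Summable fun p : ℕ × ℕ => 2 * (Real.exp (-c) ^ p.1 * Real.exp (-c) ^ p.2) :=
      (hgeo.mul_of_nonneg hgeo (fun n => by positivity) fun n => by positivity).mul_left 2
    refine ne_top_of_le_ne_top hsum.tsum_ofReal_ne_top (ENNReal.tsum_le_tsum fun p => ?_)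
    rw [← ofReal_measureReal]
    refine ENNReal.ofReal_le_ofReal ?_
    by_cases hp : 0 < p.1 * p.2
    · have hb := HasSubgaussianMGF.measure_abs_ge_le (hsub p.1 p.2) (ε := ε * (p.1 * p.2 : ℕ))
        (by positivity)
      simp only [hp, true_and]
      refine hb.trans (mul_le_mul_of_nonneg_left ?_ zero_le_two)
      rw [← Real.exp_nat_mul, ← Real.exp_nat_mul, ← Real.exp_add]
      refine Real.exp_le_exp.2 ?_
      have h1 : (1 : ℝ) ≤ p.1 := by exact_mod_cast Nat.pos_of_mul_pos_right hp
      have h2 : (1 : ℝ) ≤ p.2 := by exact_mod_cast Nat.pos_of_mul_pos_left hp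
      have h3 : (p.1 : ℝ) + p.2 ≤ 2 * (p.1 * p.2) := by nlinarith
      have h4 : -(ε * ((p.1 * p.2 : ℕ) : ℝ)) ^ 2 / (2 * (((p.1 * p.2 : ℕ) : NNReal) : ℝ)) =
          -(2 * c * (p.1 * p.2)) := by
        rw [hc]
        push_cast
        field_simp
        ring
      rw [h4]
      nlinarith
    · simp only [hp, false_and, Set.ofPred_false, measureReal_empty]
      positivity
  have hall : ∀ᵐ ω ∂μ, ∀ k : ℕ, {p : ℕ × ℕ | ω ∈ {ω | 0 < p.1 * p.2 ∧
      1 / ((k : ℝ) + 1) * (p.1 * p.2 : ℕ) ≤ |∑ n ∈ Finset.range p.1, S n p.2 ω|}}.Finite :=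
    ae_all_iff.2 fun k => key _ Nat.one_div_pos_of_nat
  filter_upwards [hall] with ω hω
  rw [Metric.tendsto_nhds]
  intro ε hε
  obtain ⟨k, hk⟩ := exists_nat_one_div_lt hε
  obtain ⟨K, hK⟩ := ((hω k).image fun p : ℕ × ℕ => p.1 * p.2).bddAbove
  refine eventually_comap.2 ((eventually_gt_atTop K).mono ?_)
  rintro m hm p rfl
  have hp : 0 < p.1 * p.2 := by omega
  have hp' : (0 : ℝ) < (p.1 * p.2 : ℕ) := by exact_mod_cast hp
  rw [Real.dist_eq, sub_zero, abs_div, abs_of_pos hp', div_lt_iff₀ hp']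
  by_contra! hcon
  refine hm.not_ge (hK ⟨p, ⟨hp, ?_⟩, rfl⟩)
  exact (mul_le_mul_of_nonneg_right hk.le hp'.le).trans hcon

end LargeDeviations

/-! ### Deterministic convergence along a trajectory -/

section Convergence

variable {V : Type*} [Fintype V] [DecidableEq V] {P : Matrix V V ℝ} {π : V → ℝ}

/-- Normalised flows that are asymptotically balanced and asymptotically split according to `P`
converge to the stationary flow. -/
lemma tendsto_stationaryFlow (hP : P ∈ Matrix.rowStochastic ℝ V) (hirr : P.IsIrreducible)
    (hπ : IsStationary P π) {α : Type*} {l : Filter α} {R : α → Matrix V V ℝ}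
    (hR0 : ∀ a i j, 0 ≤ R a i j) (hR1 : ∀ᶠ a in l, ∑ i, ∑ j, R a i j = 1)
    (hM : ∀ i j, Tendsto (fun a => R a i j - P i j * ∑ k, R a i k) l (𝓝 0))
    (hB : ∀ j, Tendsto (fun a => ∑ i, R a i j - ∑ k, R a j k) l (𝓝 0)) :
    Tendsto R l (𝓝 (Matrix.of fun i j => π i * P i j)) := by
  set u : α → V → ℝ := fun a i => ∑ k, R a i k with hu
  -- The stationarity defect is the balance error minus the summed splitting errors.
  have hdefect : ∀ j, Tendsto (fun a => Matrix.vecMul (u a) P j - u a j) l (𝓝 0) := by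
    intro j
    have h := (hB j).sub (tendsto_finsetSum Finset.univ fun i _ => hM i j)
    simp only [Finset.sum_const_zero, sub_zero] at h
    refine h.congr fun a => ?_
    have : Matrix.vecMul (u a) P j = ∑ i, P i j * ∑ k, R a i k := by
      simp only [Matrix.vecMul, dotProduct, hu, mul_comm]
    rw [this, Finset.sum_sub_distrib]
    ring
  have hlim : Tendsto u l (𝓝 π) := by
    refine (isCompact_stdSimplex ℝ V).tendsto_nhds_of_unique_mapClusterPt ?_ fun y hy hcl => ?_
    · filter_upwards [hR1] with a ha
      exact ⟨fun i => Finset.sum_nonneg fun k _ => hR0 a i k, ha⟩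
    · obtain ⟨U, hU, hUy⟩ := mapClusterPt_iff_ultrafilter.1 hcl
      refine hπ.eq hP hirr ⟨hy.1, hy.2, ?_⟩
      funext j
      have hcont : Continuous fun w : V → ℝ => Matrix.vecMul w P j - w j := by
        simp only [Matrix.vecMul, dotProduct]
        fun_prop
      exact sub_eq_zero.1
        (tendsto_nhds_unique ((hcont.tendsto y).comp hUy) ((hdefect j).mono_left hU))
  refine tendsto_pi_nhds.2 fun i => tendsto_pi_nhds.2 fun j => ?_
  have h := (hM i j).add ((tendsto_pi_nhds.1 hlim i).const_mul (P i j))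
  rw [zero_add, mul_comm] at h
  exact h.congr fun a => by simp [hu]

omit [DecidableEq V] in
lemma stationaryFlow_nonneg (hirr : P.IsIrreducible) (hπ : IsStationary P π) (i j : V) :
    0 ≤ (Matrix.of fun i j => π i * P i j) i j :=
  mul_nonneg (hπ.nonneg i) (hirr.nonneg i j)

omit [DecidableEq V] in
lemma stationaryFlow_row_sum (hP1 : ∀ i, ∑ j, P i j = 1) (i : V) :
    ∑ j, (Matrix.of fun i j => π i * P i j) i j = π i := by
  simp only [Matrix.of_apply]
  rw [← Finset.mul_sum, hP1, mul_one]

lemma stationaryFlow_ne_zero (hP : P ∈ Matrix.rowStochastic ℝ V) (hπ : IsStationary P π) :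
    (Matrix.of fun i j => π i * P i j) ≠ 0 := by
  intro h
  have h1 := hπ.sum_eq_one
  rw [Finset.sum_congr rfl fun i _ => (stationaryFlow_row_sum (π := π)
    (Matrix.sum_row_of_mem_rowStochastic hP) i).symm, h] at h1
  simp at h1

variable {Ω : Type*} {X : ℕ → ℕ → Ω → V}

omit [Fintype V] in
lemma linkFlow_apply (N T : ℕ) (ω : Ω) (i j : V) :
    linkFlow X N T ω i j = ∑ n ∈ Finset.range N, ∑ t ∈ Finset.range T,
      if X n t ω = i ∧ X n (t + 1) ω = j then (1 : ℝ) else 0 := by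
  rw [linkFlow, Matrix.of_apply, Finset.card_filter, Finset.sum_product]
  push_cast
  rfl

lemma linkFlow_row_sum (N T : ℕ) (ω : Ω) (i : V) :
    ∑ j, linkFlow X N T ω i j =
      ∑ n ∈ Finset.range N, ∑ t ∈ Finset.range T, if X n t ω = i then (1 : ℝ) else 0 := by
  simp only [linkFlow_apply]
  rw [Finset.sum_comm]
  refine Finset.sum_congr rfl fun n _ => ?_
  rw [Finset.sum_comm]
  refine Finset.sum_congr rfl fun t _ => ?_
  simp [ite_and]

lemma linkFlow_col_sum (N T : ℕ) (ω : Ω) (j : V) :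
    ∑ i, linkFlow X N T ω i j =
      ∑ n ∈ Finset.range N, ∑ t ∈ Finset.range T, if X n (t + 1) ω = j then (1 : ℝ) else 0 := by
  simp only [linkFlow_apply]
  rw [Finset.sum_comm]
  refine Finset.sum_congr rfl fun n _ => ?_
  rw [Finset.sum_comm]
  refine Finset.sum_congr rfl fun t _ => ?_
  simp [ite_and]

lemma linkFlow_sum (N T : ℕ) (ω : Ω) :
    ∑ i, ∑ j, linkFlow X N T ω i j = ((N * T : ℕ) : ℝ) := by
  simp only [linkFlow_row_sum]
  rw [Finset.sum_comm]
  simp only [Finset.sum_comm (s := (Finset.univ : Finset V))]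
  simp

/-- The deviation of a step `a → b` from the expected use of the link `(i, j)`. -/
def stepDeviation (P : Matrix V V ℝ) (i j a b : V) : ℝ :=
  if a = i then (if b = j then 1 else 0) - P i j else 0

/-- The change in the occupation of the node `j` by a trajectory over the period `T`. -/
def occupationChange (j : V) (T : ℕ) (y : ℕ → V) : ℝ :=
  (if y T = j then 1 else 0) - if y 0 = j then 1 else 0

omit [Fintype V] in
lemma abs_occupationChange_le (j : V) (T : ℕ) (y : ℕ → V) : |occupationChange j T y| ≤ 1 := by
  unfold occupationChange
  split_ifs <;> simp

lemma abs_stepDeviation_le (hP : P ∈ Matrix.rowStochastic ℝ V) (i j a b : V) :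
    |stepDeviation P i j a b| ≤ 1 := by
  have h0 : 0 ≤ P i j := Matrix.nonneg_of_mem_rowStochastic hP
  have h1 : P i j ≤ 1 := Matrix.le_one_of_mem_rowStochastic hP
  unfold stepDeviation
  split_ifs <;> rw [abs_le] <;> constructor <;> linarith

lemma sum_mul_stepDeviation (hP : P ∈ Matrix.rowStochastic ℝ V) (i j a : V) :
    ∑ b, P a b * stepDeviation P i j a b = 0 := by
  unfold stepDeviation
  split_ifs with h
  · subst h
    simp [mul_sub, ← Finset.sum_mul, Matrix.sum_row_of_mem_rowStochastic hP]
  · simp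

lemma linkFlow_sub (N T : ℕ) (ω : Ω) (i j : V) :
    linkFlow X N T ω i j - P i j * ∑ k, linkFlow X N T ω i k =
      ∑ n ∈ Finset.range N, ∑ t ∈ Finset.range T,
        stepDeviation P i j (X n t ω) (X n (t + 1) ω) := by
  rw [linkFlow_row_sum, linkFlow_apply, Finset.mul_sum, ← Finset.sum_sub_distrib]
  refine Finset.sum_congr rfl fun n _ => ?_
  rw [Finset.mul_sum, ← Finset.sum_sub_distrib]
  refine Finset.sum_congr rfl fun t _ => ?_
  unfold stepDeviation
  by_cases h : X n t ω = i <;> simp [h]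

/-- Arrivals minus departures telescope in time, leaving only the endpoints of each trajectory. -/
lemma linkFlow_col_sum_sub (N T : ℕ) (ω : Ω) (j : V) :
    ∑ i, linkFlow X N T ω i j - ∑ k, linkFlow X N T ω j k =
      ∑ n ∈ Finset.range N, occupationChange j T fun t => X n t ω := by
  rw [linkFlow_row_sum, linkFlow_col_sum, ← Finset.sum_sub_distrib]
  refine Finset.sum_congr rfl fun n _ => ?_
  rw [← Finset.sum_sub_distrib, Finset.sum_range_sub fun t => if X n t ω = j then (1 : ℝ) else 0]
  rfl

/-- Along trajectories that use only links of `P`, the relative flow converges to the ideal flow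
as soon as the step deviations and the occupation changes average to zero. -/
lemma tendsto_relativeFlow_linkFlow (hP : P ∈ Matrix.rowStochastic ℝ V) (hirr : P.IsIrreducible)
    (hπ : IsStationary P π) {l : Filter (ℕ × ℕ)}
    (hl : l ≤ comap (fun p : ℕ × ℕ => p.1 * p.2) atTop) {ω : Ω}
    (hz : ∀ n t i j, P i j = 0 → ¬(X n t ω = i ∧ X n (t + 1) ω = j))
    (hM : ∀ i j, Tendsto (fun p : ℕ × ℕ => (∑ n ∈ Finset.range p.1, ∑ t ∈ Finset.range p.2,
      stepDeviation P i j (X n t ω) (X n (t + 1) ω)) / ((p.1 * p.2 : ℕ) : ℝ)) l (𝓝 0))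
    (hB : ∀ j, Tendsto (fun p : ℕ × ℕ => (∑ n ∈ Finset.range p.1,
      occupationChange j p.2 fun t => X n t ω) / ((p.1 * p.2 : ℕ) : ℝ)) l (𝓝 0)) :
    Tendsto (fun p : ℕ × ℕ => relativeFlow (linkFlow X p.1 p.2 ω)) l
      (𝓝 (relativeFlow (Matrix.of fun i j => π i * P i j))) := by
  have hpos : ∀ᶠ p : ℕ × ℕ in l, 0 < p.1 * p.2 :=
    (tendsto_iff_comap.2 hl).eventually (eventually_gt_atTop 0)
  set R : ℕ × ℕ → Matrix V V ℝ := fun p => ((p.1 * p.2 : ℕ) : ℝ)⁻¹ • linkFlow X p.1 p.2 ω with hR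
  have hRsum : ∀ p i, ∑ k, R p i k = ((p.1 * p.2 : ℕ) : ℝ)⁻¹ * ∑ k, linkFlow X p.1 p.2 ω i k :=
    fun p i => by rw [Finset.mul_sum]; rfl
  have hRsum' : ∀ p j, ∑ k, R p k j = ((p.1 * p.2 : ℕ) : ℝ)⁻¹ * ∑ k, linkFlow X p.1 p.2 ω k j :=
    fun p i => by rw [Finset.mul_sum]; rfl
  have hlim : Tendsto R l (𝓝 (Matrix.of fun i j => π i * P i j)) := by
    refine tendsto_stationaryFlow hP hirr hπ (fun p i j => ?_) ?_ (fun i j => ?_) fun j => ?_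
    · exact mul_nonneg (by positivity) (Nat.cast_nonneg _)
    · filter_upwards [hpos] with p hp
      simp only [hRsum]
      rw [← Finset.mul_sum, linkFlow_sum]
      exact inv_mul_cancel₀ (by exact_mod_cast hp.ne')
    · refine (hM i j).congr fun p => ?_
      rw [← linkFlow_sub, hRsum, div_eq_inv_mul]
      simp only [hR, Matrix.smul_apply, smul_eq_mul]
      ring
    · refine (hB j).congr fun p => ?_
      rw [← linkFlow_col_sum_sub, hRsum, hRsum', div_eq_inv_mul]
      ring
  refine (tendsto_relativeFlow (stationaryFlow_nonneg hirr hπ) (stationaryFlow_ne_zero hP hπ) hlim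
    fun p i j hij => ?_).congr' ?_
  · have hPij : P i j = 0 := (mul_eq_zero.1 hij).resolve_left (hπ.pos hirr i).ne'
    have : linkFlow X p.1 p.2 ω i j = 0 := by
      rw [linkFlow_apply]
      exact Finset.sum_eq_zero fun n _ => Finset.sum_eq_zero fun t _ => if_neg (hz n t i j hPij)
    simp only [hR, Matrix.smul_apply, this, smul_zero]
  · filter_upwards [hpos] with p hp
    exact relativeFlow_smul (inv_pos.2 (by exact_mod_cast hp)) _

/-- The left filter encodes `T → ∞` uniformly in `N ≥ 1`; there `T ≤ N * T`. -/
lemma prod_principal_atTop_le_comap_mul :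
    𝓟 {N : ℕ | 1 ≤ N} ×ˢ (atTop : Filter ℕ) ≤ comap (fun p : ℕ × ℕ => p.1 * p.2) atTop := by
  refine tendsto_iff_comap.1 (tendsto_atTop_mono' _ ?_ tendsto_snd)
  have : ∀ᶠ N in 𝓟 {N : ℕ | 1 ≤ N}, 1 ≤ N := mem_principal_self _
  filter_upwards [tendsto_fst.eventually this] with p hp
  exact Nat.le_mul_of_pos_left _ hp

omit [Fintype V] in
lemma tendsto_average_occupationChange (j : V) (y : ℕ → ℕ → V) :
    Tendsto (fun p : ℕ × ℕ => (∑ n ∈ Finset.range p.1, occupationChange j p.2 (y n)) /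
      ((p.1 * p.2 : ℕ) : ℝ)) (𝓟 {N : ℕ | 1 ≤ N} ×ˢ atTop) (𝓝 0) := by
  have hlim : Tendsto (fun p : ℕ × ℕ => 1 / (p.2 : ℝ)) (𝓟 {N : ℕ | 1 ≤ N} ×ˢ atTop) (𝓝 0) :=
    (tendsto_const_div_atTop_nhds_zero_nat 1).comp tendsto_snd
  refine squeeze_zero_norm' ?_ hlim
  have : ∀ᶠ N in 𝓟 {N : ℕ | 1 ≤ N}, 1 ≤ N := mem_principal_self _
  filter_upwards [tendsto_fst.eventually this] with p hp
  have hN : (0 : ℝ) < p.1 := by exact_mod_cast hp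
  have hsum : |∑ n ∈ Finset.range p.1, occupationChange j p.2 (y n)| ≤ p.1 :=
    (Finset.abs_sum_le_sum_abs _ _).trans
      ((Finset.sum_le_sum fun n _ => abs_occupationChange_le j p.2 (y n)).trans (by simp))
  rw [Real.norm_eq_abs, abs_div, Nat.abs_cast, Nat.cast_mul]
  calc |∑ n ∈ Finset.range p.1, occupationChange j p.2 (y n)| / ((p.1 : ℝ) * p.2)
      ≤ p.1 / ((p.1 : ℝ) * p.2) := by gcongr
    _ = 1 / (p.2 : ℝ) := by rw [← div_div, div_self hN.ne']

end Convergence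

/-! ### Almost sure convergence for independent agents -/

section AlmostSure

variable {V Ω : Type*} [Fintype V] [DecidableEq V] [MeasurableSpace V]
  [MeasurableSingletonClass V] [MeasurableSpace Ω] {P : Matrix V V ℝ} {π : V → ℝ}
  {μ : Measure Ω} [IsProbabilityMeasure μ]

omit [IsProbabilityMeasure μ] in
lemma HasSubgaussianMGF.mono {Z : Ω → ℝ} {c d : NNReal} (h : HasSubgaussianMGF Z c μ)
    (hcd : c ≤ d) : HasSubgaussianMGF Z d μ :=
  ⟨h.integrable_exp_mul, fun t => (h.mgf_le t).trans (Real.exp_le_exp.2 (by gcongr))⟩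

lemma measurable_occupationChange (j : V) (T : ℕ) :
    Measurable (occupationChange j T : (ℕ → V) → ℝ) := by
  have h : ∀ t, Measurable fun y : ℕ → V => if y t = j then (1 : ℝ) else 0 := fun t =>
    (Measurable.of_discrete (f := fun a : V => if a = j then (1 : ℝ) else 0)).comp
      (measurable_pi_apply t)
  exact (h T).sub (h 0)

/-- For a walk started from a stationary law, the occupation changes are sub-Gaussian. -/
lemma IsRandomWalk.hasSubgaussianMGF_occupationChange {Y : ℕ → Ω → V} (hY : IsRandomWalk P μ Y)
    (hπ : Matrix.vecMul π P = π) (h0 : ∀ i, μ.real {ω | Y 0 ω = i} = π i) (j : V) (T : ℕ) :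
    HasSubgaussianMGF (fun ω => occupationChange j T fun t => Y t ω) T μ := by
  -- Proxy `0` is correct at `T = 0`, where the change vanishes. For `T ≥ 1`, Hoeffding's lemma on
  -- `[-1, 1]` gives proxy `1 ≤ T`.
  rcases T.eq_zero_or_pos with rfl | hT
  · simp [occupationChange]
  have hms : ∀ t, MeasurableSet {ω | Y t ω = j} := fun t =>
    hY.measurable t (measurableSet_singleton j)
  have hint : ∀ t, Integrable (fun ω => if Y t ω = j then (1 : ℝ) else 0) μ := fun t => by
    refine Integrable.of_mem_Icc 0 1 ?_ (ae_of_all _ fun ω => by split_ifs <;> simp)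
    exact (Measurable.ite (hms t) measurable_const measurable_const).aemeasurable
  have hval : ∀ t, ∫ ω, (if Y t ω = j then (1 : ℝ) else 0) ∂μ = π j := fun t => by
    rw [← hY.measureReal_eq hπ h0 t j, ← integral_indicator_one (hms t)]
    exact integral_congr_ae (ae_of_all _ fun ω => by simp [Set.indicator_apply])
  refine HasSubgaussianMGF.mono (hasSubgaussianMGF_of_mem_Icc_of_integral_eq_zero
    (a := -1) (b := 1) ?_ (ae_of_all _ fun ω => ?_) ?_) (c := (‖(1 : ℝ) - -1‖₊ / 2) ^ 2) ?_
  · exact ((measurable_occupationChange j T).comp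
      (measurable_pi_lambda _ hY.measurable)).aemeasurable
  · exact abs_le.1 (abs_occupationChange_le j T _)
  · simp only [occupationChange]
    rw [integral_sub (hint T) (hint 0), hval, hval, sub_self]
  · have : ‖(1 : ℝ) - -1‖₊ = 2 := by
      rw [← NNReal.coe_inj]
      norm_num
    rw [this, div_self two_ne_zero, one_pow]
    exact_mod_cast hT

/-- The relative flow of independent random walks converges almost surely to the ideal flow, as
the period grows, uniformly in the number of agents. -/
lemma ae_tendsto_relativeFlow (hP : P ∈ Matrix.rowStochastic ℝ V) (hirr : P.IsIrreducible)
    (hπ : IsStationary P π) {X : ℕ → ℕ → Ω → V} (hX : ∀ n, IsRandomWalk P μ (X n))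
    (hind : iIndepFun (fun n ω t => X n t ω) μ) :
    (∀ᵐ ω ∂μ, Tendsto (fun p : ℕ × ℕ => relativeFlow (linkFlow X p.1 p.2 ω))
      (𝓟 {N : ℕ | 1 ≤ N} ×ˢ atTop) (𝓝 (relativeFlow (Matrix.of fun i j => π i * P i j)))) ∧
    ((∀ n i, μ.real {ω | X n 0 ω = i} = π i) →
      ∀ᵐ ω ∂μ, Tendsto (fun p : ℕ × ℕ => relativeFlow (linkFlow X p.1 p.2 ω))
        (comap (fun p : ℕ × ℕ => p.1 * p.2) atTop)
        (𝓝 (relativeFlow (Matrix.of fun i j => π i * P i j)))) := by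
  have hz : ∀ᵐ ω ∂μ, ∀ n t i j, P i j = 0 → ¬(X n t ω = i ∧ X n (t + 1) ω = j) := by
    simp only [ae_all_iff]
    exact fun n t i j hij => (hX n).ae_step_ne hij t
  have hM : ∀ᵐ ω ∂μ, ∀ i j, Tendsto
      (fun p : ℕ × ℕ => (∑ n ∈ Finset.range p.1, ∑ t ∈ Finset.range p.2,
        stepDeviation P i j (X n t ω) (X n (t + 1) ω)) / ((p.1 * p.2 : ℕ) : ℝ))
      (comap (fun p : ℕ × ℕ => p.1 * p.2) atTop) (𝓝 0) := by
    simp only [ae_all_iff]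
    intro i j
    refine ae_tendsto_average_zero (S := fun n T ω => ∑ t ∈ Finset.range T,
      stepDeviation P i j (X n t ω) (X n (t + 1) ω)) (fun n T => ?_) fun T => ?_
    · exact (hX n).hasSubgaussianMGF_sum hirr.nonneg (Matrix.sum_row_of_mem_rowStochastic hP)
        (abs_stepDeviation_le hP i j) (sum_mul_stepDeviation hP i j) T
    · refine hind.comp (fun _ y => ∑ t ∈ Finset.range T, stepDeviation P i j (y t) (y (t + 1)))
        fun _ => Finset.measurable_fun_sum _ fun t _ => ?_
      have hpair : Measurable fun y : ℕ → V => (y t, y (t + 1)) :=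
        (measurable_pi_apply t).prodMk (measurable_pi_apply (t + 1))
      exact (Measurable.of_discrete (f := fun p : V × V => stepDeviation P i j p.1 p.2)).comp hpair
  refine ⟨?_, fun h0 => ?_⟩
  · filter_upwards [hz, hM] with ω hzω hMω
    exact tendsto_relativeFlow_linkFlow hP hirr hπ prod_principal_atTop_le_comap_mul hzω
      (fun i j => (hMω i j).mono_left prod_principal_atTop_le_comap_mul)
      fun j => tendsto_average_occupationChange j fun n t => X n t ω
  · have hB : ∀ᵐ ω ∂μ, ∀ j, Tendsto (fun p : ℕ × ℕ => (∑ n ∈ Finset.range p.1,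
        occupationChange j p.2 fun t => X n t ω) / ((p.1 * p.2 : ℕ) : ℝ))
        (comap (fun p : ℕ × ℕ => p.1 * p.2) atTop) (𝓝 0) := by
      simp only [ae_all_iff]
      intro j
      refine ae_tendsto_average_zero (S := fun n T ω => occupationChange j T fun t => X n t ω)
        (fun n T => ?_) fun T => ?_
      · exact (hX n).hasSubgaussianMGF_occupationChange hπ.vecMul_eq (h0 n) j T
      · exact hind.comp (fun _ => occupationChange j T) fun _ => measurable_occupationChange j T
    filter_upwards [hz, hM, hB] with ω hzω hMω hBω
    exact tendsto_relativeFlow_linkFlow hP hirr hπ le_rfl hzω hMω hBω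

end AlmostSure

/-! ### Premagic, rational and integral flows -/

section IdealFlowMatrix

variable {V : Type*} [Fintype V]

lemma isPremagic_iff {R : Type*} [NonAssocSemiring R] {M : Matrix V V R} :
    IsPremagic M ↔ ∀ i, ∑ k, M k i = ∑ k, M i k := by
  simp [IsPremagic, funext_iff, Matrix.vecMul, Matrix.mulVec, dotProduct]

lemma IsPremagic.smul {R : Type*} [NonAssocSemiring R] {M : Matrix V V R} (h : IsPremagic M)
    (c : R) : IsPremagic (c • M) := by
  rw [isPremagic_iff] at h ⊢
  intro i
  simp only [Matrix.smul_apply, smul_eq_mul]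
  rw [← Finset.mul_sum, ← Finset.mul_sum, h]

lemma isPremagic_of_map_natCast {W : Matrix V V ℕ}
    (h : IsPremagic (W.map fun m : ℕ => (m : ℝ))) : IsPremagic W := by
  rw [isPremagic_iff] at h ⊢
  intro i
  have := h i
  simp only [Matrix.map_apply] at this
  exact_mod_cast this

variable {P : Matrix V V ℝ} {π : V → ℝ}

lemma isPremagic_stationaryFlow (hP1 : ∀ i, ∑ j, P i j = 1) (hπ : IsStationary P π) :
    IsPremagic (Matrix.of fun i j => π i * P i j) := by
  rw [isPremagic_iff]
  intro i
  rw [stationaryFlow_row_sum hP1]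
  exact congrFun hπ.vecMul_eq i

/-- Row `i` of the scaled flow sums to `c * π i`, so dividing by row sums recovers `P` by rational
operations. -/
lemma exists_rat_of_idealFlow_rat (hP1 : ∀ i, ∑ j, P i j = 1) (hpos : ∀ i, 0 < π i)
    {c : ℝ} (hc : 0 < c) {G : Matrix V V ℚ}
    (hG : c • (Matrix.of fun i j => π i * P i j) = G.map (fun q : ℚ => (q : ℝ))) :
    ∃ Q : Matrix V V ℚ, P = Q.map (fun q : ℚ => (q : ℝ)) := by
  refine ⟨Matrix.of fun i j => G i j / ∑ k, G i k, ?_⟩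
  have hent : ∀ i j, ((G i j : ℚ) : ℝ) = c * (π i * P i j) := fun i j =>
    (congrFun (congrFun hG i) j).symm
  ext i j
  simp only [Matrix.map_apply, Matrix.of_apply]
  push_cast
  simp only [hent]
  rw [← Finset.mul_sum, ← Finset.mul_sum, hP1, mul_one, ← mul_assoc,
    mul_div_cancel_left₀ _ (mul_pos hc (hpos i)).ne']

/-- An invariant vector found over `ℚ` is also stationary over `ℝ`, so uniqueness identifies it with
`π`. -/
lemma exists_rat_stationary [DecidableEq V] [Nonempty V] (hP : P ∈ Matrix.rowStochastic ℝ V)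
    (hirr : P.IsIrreducible) (hπ : IsStationary P π) {Q : Matrix V V ℚ}
    (hQ : P = Q.map (fun q : ℚ => (q : ℝ))) : ∃ q : V → ℚ, ∀ i, π i = q i := by
  have hent : ∀ i j, P i j = (Q i j : ℝ) := fun i j => by rw [hQ]; rfl
  have hQs : Q ∈ Matrix.rowStochastic ℚ V := by
    refine Matrix.mem_rowStochastic_iff_sum.2 ⟨fun i j => ?_, fun i => ?_⟩
    · have := Matrix.nonneg_of_mem_rowStochastic hP (i := i) (j := j)
      rw [hent] at this
      exact_mod_cast this
    · have := Matrix.sum_row_of_mem_rowStochastic hP i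
      simp only [hent] at this
      exact_mod_cast this
  obtain ⟨q, hq0, hq1, hqQ⟩ := exists_invariant hQs
  refine ⟨q, fun i => ?_⟩
  have hst : IsStationary P fun i => (q i : ℝ) := by
    refine ⟨fun i => by exact_mod_cast hq0 i, by exact_mod_cast hq1, ?_⟩
    funext j
    have := congrFun hqQ j
    simp only [Matrix.vecMul, dotProduct] at this ⊢
    simp only [hent]
    exact_mod_cast this
  rw [← hπ.eq hP hirr hst]

lemma exists_rat_relativeFlow {R : Matrix V V ℝ} {G : Matrix V V ℚ}
    (hR : R = G.map (fun q : ℚ => (q : ℝ))) :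
    ∃ H : Matrix V V ℚ, relativeFlow R = H.map (fun q : ℚ => (q : ℝ)) := by
  by_cases h0 : R = 0
  · refine ⟨0, ?_⟩
    ext i j
    simp [relativeFlow, h0]
  obtain ⟨a, b, -, hab⟩ := minFlow_mem h0
  refine ⟨Matrix.of fun i j => G i j / G a b, ?_⟩
  ext i j
  rw [relativeFlow, Matrix.of_apply, ← hab, hR]
  simp

lemma denLcm_pos (G : Matrix V V ℚ) : 0 < denLcm G :=
  Nat.pos_of_ne_zero fun h => by
    obtain ⟨p, -, hp⟩ := Finset.lcm_eq_zero_iff.1 h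
    exact (G p.1 p.2).den_nz hp

lemma exists_natCast_eq_denLcm_smul {G : Matrix V V ℚ} (hG : ∀ i j, 0 ≤ G i j) :
    ∃ W : Matrix V V ℕ, ∀ i j, (W i j : ℚ) = denLcm G * G i j := by
  refine ⟨Matrix.of fun i j => denLcm G / (G i j).den * (G i j).num.toNat, fun i j => ?_⟩
  have hdvd : (G i j).den ∣ denLcm G :=
    Finset.dvd_lcm (f := fun p : V × V => (G p.1 p.2).den) (Finset.mem_univ (i, j))
  have hden : ((G i j).den : ℚ) ≠ 0 := by exact_mod_cast (G i j).den_nz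
  have hnum : (((G i j).num.toNat : ℕ) : ℚ) = (G i j).num := by
    exact_mod_cast congrArg (Int.cast : ℤ → ℚ) (Int.toNat_of_nonneg (Rat.num_nonneg.2 (hG i j)))
  rw [Matrix.of_apply, Nat.cast_mul, Nat.cast_div hdvd hden, hnum]
  conv_rhs => rw [← Rat.num_div_den (G i j)]
  rw [div_mul_eq_mul_div, mul_div_assoc]

end IdealFlowMatrix

end IdealFlow

theorem theorem10 {V : Type*} [Fintype V] [DecidableEq V] [Nonempty V]
    [MeasurableSpace V] [MeasurableSingletonClass V]
    (P : Matrix V V ℝ) (hP : P ∈ Matrix.rowStochastic ℝ V) (hirr : P.IsIrreducible) :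
    ∃ (π : V → ℝ) (F : Matrix V V ℝ),
      -- the stationary distribution exists, is unique, and is positive
      IdealFlow.IsStationary P π ∧ (∀ π', IdealFlow.IsStationary P π' → π' = π) ∧
      (∀ i, 0 < π i) ∧
      -- the ideal flow is the relative flow of the stationary flow
      F = IdealFlow.relativeFlow (Matrix.of fun i j => π i * P i j) ∧
      -- almost surely the relative flow of independent agents converges to it
      (∀ {Ω : Type*} [MeasurableSpace Ω] (μ : Measure Ω) [IsProbabilityMeasure μ]
        (X : ℕ → ℕ → Ω → V), (∀ n, IdealFlow.IsRandomWalk P μ (X n)) →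
        iIndepFun (fun n ω t => X n t ω) μ →
        (∀ᵐ ω ∂μ, Tendsto
          (fun p : ℕ × ℕ => IdealFlow.relativeFlow (IdealFlow.linkFlow X p.1 p.2 ω))
          (𝓟 {N : ℕ | 1 ≤ N} ×ˢ atTop) (𝓝 F)) ∧
        ((∀ n i, μ.real {ω | X n 0 ω = i} = π i) →
          ∀ᵐ ω ∂μ, Tendsto
            (fun p : ℕ × ℕ => IdealFlow.relativeFlow (IdealFlow.linkFlow X p.1 p.2 ω))
            (comap (fun p : ℕ × ℕ => p.1 * p.2) atTop) (𝓝 F))) ∧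
      IdealFlow.IsPremagic F ∧
      -- rationality of the entries
      ((∃ Q : Matrix V V ℚ, P = Q.map (fun q : ℚ => (q : ℝ))) ↔
        ∃ G : Matrix V V ℚ, F = G.map (fun q : ℚ => (q : ℝ))) ∧
      -- scaling by the least common multiple of the denominators
      (∀ G : Matrix V V ℚ, F = G.map (fun q : ℚ => (q : ℝ)) →
        0 < IdealFlow.denLcm G ∧
        ∃ W : Matrix V V ℕ,
          (IdealFlow.denLcm G : ℝ) • F = W.map (fun m : ℕ => (m : ℝ)) ∧
          IdealFlow.IsPremagic W ∧
          IdealFlow.relativeFlow (W.map (fun m : ℕ => (m : ℝ))) = F) := by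
  have hP1 := Matrix.sum_row_of_mem_rowStochastic hP
  obtain ⟨π, h0, h1, hv⟩ := IdealFlow.exists_invariant hP
  have hπ : IdealFlow.IsStationary P π := ⟨h0, h1, hv⟩
  set A : Matrix V V ℝ := Matrix.of fun i j => π i * P i j with hA
  have hA0 : ∀ i j, 0 ≤ A i j := IdealFlow.stationaryFlow_nonneg hirr hπ
  have hm : 0 < IdealFlow.minFlow A :=
    IdealFlow.minFlow_pos hA0 (IdealFlow.stationaryFlow_ne_zero hP hπ)
  have hF : IdealFlow.relativeFlow A = (IdealFlow.minFlow A)⁻¹ • A :=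
    IdealFlow.relativeFlow_eq_smul A
  have hmagic : IdealFlow.IsPremagic (IdealFlow.relativeFlow A) :=
    hF ▸ (IdealFlow.isPremagic_stationaryFlow hP1 hπ).smul _
  refine ⟨π, IdealFlow.relativeFlow A, hπ, fun π' h' => hπ.eq hP hirr h', hπ.pos hirr, rfl,
    fun μ _ X hX hind => IdealFlow.ae_tendsto_relativeFlow hP hirr hπ hX hind, hmagic,
    ⟨?_, ?_⟩, ?_⟩
  · rintro ⟨Q, hQ⟩
    obtain ⟨q, hq⟩ := IdealFlow.exists_rat_stationary hP hirr hπ hQ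
    refine IdealFlow.exists_rat_relativeFlow (G := Matrix.of fun i j => q i * Q i j) ?_
    ext i j
    simp [hA, hq, hQ]
  · rintro ⟨G, hG⟩
    rw [hF] at hG
    exact IdealFlow.exists_rat_of_idealFlow_rat hP1 (hπ.pos hirr) (inv_pos.2 hm) hG
  · intro G hG
    have hL : (0 : ℝ) < IdealFlow.denLcm G := by exact_mod_cast IdealFlow.denLcm_pos G
    have hG0 : ∀ i j, 0 ≤ G i j := fun i j => by
      have hij : ((G i j : ℚ) : ℝ) = (IdealFlow.minFlow A)⁻¹ * A i j := by
        rw [← smul_eq_mul, ← Matrix.smul_apply, ← hF, hG, Matrix.map_apply]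
      have : (0 : ℝ) ≤ (G i j : ℚ) := hij ▸ mul_nonneg (inv_nonneg.2 hm.le) (hA0 i j)
      exact_mod_cast this
    obtain ⟨W, hW⟩ := IdealFlow.exists_natCast_eq_denLcm_smul hG0
    have hWF : (IdealFlow.denLcm G : ℝ) • IdealFlow.relativeFlow A =
        W.map (fun m : ℕ => (m : ℝ)) := by
      ext i j
      rw [hG, Matrix.smul_apply, Matrix.map_apply, Matrix.map_apply, smul_eq_mul]
      exact_mod_cast (hW i j).symm
    refine ⟨IdealFlow.denLcm_pos G, W, hWF, ?_, ?_⟩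
    · exact IdealFlow.isPremagic_of_map_natCast (hWF ▸ hmagic.smul _)
    -- `F` is itself a positive multiple of `A`, so two uses of scale invariance return `F`.
    · rw [← hWF, IdealFlow.relativeFlow_smul hL]
      conv_lhs => rw [hF]
      exact IdealFlow.relativeFlow_smul (inv_pos.2 hm) A
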